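/- Theorem 1.6. Let $D=d/dz$ and $H^*=\{w\in\mathbb C:\operatorname{Im} w<0\}$. Let $\lambda\ge 0$ and $\mu$ be real numbers, and let $h:\mathbb C\to\mathbb C$ be the limit, uniform on compact subsets of $\mathbb C$, of a sequence of complex polynomials none of which has a zero in $H^*$. Let $h^*(z)=\overline{h(\bar z)}$. For an entire function $f(w)=\sum_{k\ge0} c_kw^k$ let $f(D)=\sum_{k\ge 0} c_kD^k$, acting on $\mathbb C[z]$. Let $T=\sum_{k\ge0}a_kD^k$ $(a_k\in\mathbb C)$ be the operator $T=h(D)e^{i\lambda D}$ on $\mathbb C[z]$, and let $T^*=\sum_{k\ge0}\overline{a_k}D^k$. If $p$ is a nonzero polynomial with real coefficients all of whose zeros lie in $\{z\in\mathbb C:|\operatorname{Im} z|\le\mu\}$, then $$(T+T^*)(p(z)) = h(D)p(z+i\lambda)+h^*(D)p(z-i\lambda),$$ and this polynomial is either identically zero or a polynomial with real coefficients all of whose zeros lie in $\{z\in\mathbb C:|\operatorname{Im} z|\le\delta\}$, where $\delta=\sqrt{\max\{\mu^2-\lambda^2,0\}}$. -/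

import Mathlib

open Polynomial

namespace StripPreserver

/-- `𝒫(Ω)`: the complex polynomials with no zero in `Ω` (in particular, the zero polynomial is
excluded when `Ω` is nonempty). -/
def stablePolys (Ω : Set ℂ) : Set ℂ[X] :=
  {p | ∀ z ∈ Ω, p.eval z ≠ 0}

/-- The open upper half-plane `H`. -/
def upperHalf : Set ℂ := {z | 0 < z.im}

/-- `Ω* = {conj ζ : ζ ∈ Ω}`. -/
def conjSet (Ω : Set ℂ) : Set ℂ := (starRingEnd ℂ) '' Ω

/-- The closure of `𝒫(Ω)` under uniform limits on the compact subsets of `ℂ`, as a set of functions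
on `ℂ`. (This mode of convergence is metrizable, so that sequences suffice.) -/
def stableClosure (Ω : Set ℂ) : Set (ℂ → ℂ) :=
  {f | ∃ p : ℕ → ℂ[X], (∀ n, p n ∈ stablePolys Ω) ∧
    ∀ K : Set ℂ, IsCompact K →
      TendstoUniformlyOn (fun n z => (p n).eval z) f Filter.atTop K}

/-- `S_μ`: the complex polynomials all of whose zeros lie in the strip `|Im z| ≤ μ`. -/
def stripPolys (μ : ℝ) : Set ℂ[X] := stablePolys {z | μ < |z.im|}

/-- `S_μ(ℝ)`: the members of `S_μ` with real coefficients. -/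
def realStripPolys (μ : ℝ) : Set ℂ[X] :=
  stripPolys μ ∩ Set.range (Polynomial.map (algebraMap ℝ ℂ))

theorem sum_derivative_eq (a : ℕ → ℂ) (p : ℂ[X]) {n : ℕ} (hn : p.natDegree < n) :
    ∑ k ∈ Finset.range (p.natDegree + 1), a k • derivative^[k] p =
      ∑ k ∈ Finset.range n, a k • derivative^[k] p := by
  apply Finset.sum_subset
  · intro k hk
    rw [Finset.mem_range] at hk ⊢
    omega
  · intro k _ hk
    rw [Finset.mem_range] at hk
    rw [iterate_derivative_eq_zero (by omega), smul_zero]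

/-- The differential operator `∑ a_k D^k` with constant coefficients on `ℂ[z]`. The sum is finite on
each polynomial, since `D^k p = 0` for `k > deg p`. -/
noncomputable def diffOp (a : ℕ → ℂ) : ℂ[X] →ₗ[ℂ] ℂ[X] where
  toFun p := ∑ k ∈ Finset.range (p.natDegree + 1), a k • derivative^[k] p
  map_add' p q := by
    have h := natDegree_add_le p q
    rw [sum_derivative_eq a (p + q) (n := max p.natDegree q.natDegree + 1) (by omega),
      sum_derivative_eq a p (n := max p.natDegree q.natDegree + 1) (by omega),
      sum_derivative_eq a q (n := max p.natDegree q.natDegree + 1) (by omega),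
      ← Finset.sum_add_distrib]
    exact Finset.sum_congr rfl fun k _ => by rw [iterate_map_add, smul_add]
  map_smul' c p := by
    have h := natDegree_smul_le c p
    rw [sum_derivative_eq a (c • p) (n := p.natDegree + 1) (by omega), RingHom.id_apply,
      Finset.smul_sum]
    exact Finset.sum_congr rfl fun k _ => by rw [iterate_derivative_smul, smul_comm]

/-- The Taylor coefficients of `f` at the origin. -/
noncomputable def taylorCoeffs (f : ℂ → ℂ) (k : ℕ) : ℂ := iteratedDeriv k f 0 / (k.factorial : ℂ)

/-- `f(D)` for an entire function `f`. -/
noncomputable def entireOp (f : ℂ → ℂ) : ℂ[X] →ₗ[ℂ] ℂ[X] := diffOp (taylorCoeffs f)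

/-- `f*(z) = conj (f (conj z))`. -/
noncomputable def conjFun (f : ℂ → ℂ) (z : ℂ) : ℂ := (starRingEnd ℂ) (f ((starRingEnd ℂ) z))

/-- `(shift c p)(z) = p (z + c)`. -/
noncomputable def shift (c : ℂ) (p : ℂ[X]) : ℂ[X] := p.comp (X + C c)

end StripPreserver

/-!
For a polynomial `F` let `F*(z) = conj (F (conj z))`. The sum in question is `G + G*` with
`G = h(D) F` and `F(z) = p(z + iλ)`: since `p` is real, `F*(z) = p(z - iλ)`, and `T*` acts on real
polynomials as the conjugate of `T`. So the sum is real, and it suffices to exclude its zeros in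
`Im z > δ`.

The proof follows a property of Hermite–Biehler type, `HermiteBiehler δ F`: above the line
`Im z = δ`, `F` has no zero and `|F*| ≤ |F|`. Equivalently, no member of the pencil `F + ω F*` with
`|ω| < 1` has a zero there.

* `F(z) = p(z + iλ)` has the property (`hermiteBiehler_shift`), by comparing the distances from
  `z ± iλ` to a zero `ρ` of `p` and to `conj ρ`.
* `D - α` with `Im α ≥ 0` preserves the property or annihilates `F`
  (`HermiteBiehler.derivative_sub`). For nonconstant `F`, all members of the pencil have a
  logarithmic derivative with negative imaginary part above the line. This excludes zeros of
  `F' - αF`; it gives `|(F*)' - aF*| ≤ |F' - aF|` for real `a`; and averaging over `±ω` gives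
  `Im (F' conj F) + Im ((F*)' conj F*) ≤ 0`. The last two inequalities with `a = Re α`, and
  `|F*| ≤ |F|`, combine to `|(F*)' - conj α F*| ≤ |F' - αF|`. Hence `q(D)` preserves the property
  for every polynomial `q` without zeros in the lower half-plane.
* If `q n → h`, then the coefficients converge to the Taylor coefficients of `h`. The polynomials
  `q n(D) F + ω n (q n(D) F)*` with `ω n ↑ 1` have bounded degree, vanish identically
  or have no zeros above the line, and converge to `G + G*`. A Hurwitz-type argument
  (`eq_zero_or_forall_ne_zero_of_tendsto`) finishes the proof.
-/

namespace StripPreserver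

open ComplexConjugate Filter Topology

/-! ### Conjugation of polynomials -/

/-- The polynomial `p*` with `p*(z) = conj (p (conj z))`, i.e. with conjugated coefficients. -/
noncomputable def conjPoly (p : ℂ[X]) : ℂ[X] := p.map (starRingEnd ℂ)

theorem eval_conjPoly (p : ℂ[X]) (z : ℂ) : (conjPoly p).eval z = conj (p.eval (conj z)) := by
  have := Polynomial.eval_map_apply (f := starRingEnd ℂ) (p := p) (conj z)
  rwa [Complex.conj_conj] at this

theorem coeff_conjPoly (p : ℂ[X]) (n : ℕ) : (conjPoly p).coeff n = conj (p.coeff n) :=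
  coeff_map _ _

theorem conjPoly_conjPoly (p : ℂ[X]) : conjPoly (conjPoly p) = p := by
  ext n
  simp [coeff_conjPoly]

theorem conjPoly_zero : conjPoly 0 = 0 := Polynomial.map_zero _

theorem conjPoly_add (p q : ℂ[X]) : conjPoly (p + q) = conjPoly p + conjPoly q :=
  Polynomial.map_add _

theorem natDegree_conjPoly (p : ℂ[X]) : (conjPoly p).natDegree = p.natDegree :=
  natDegree_map _

theorem derivative_conjPoly (p : ℂ[X]) : derivative (conjPoly p) = conjPoly (derivative p) :=
  derivative_map p _

theorem conjPoly_shift (c : ℂ) (p : ℂ[X]) : conjPoly (shift c p) = shift (conj c) (conjPoly p) := by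
  simp [conjPoly, shift, Polynomial.map_comp]

theorem mem_range_map_real_iff (p : ℂ[X]) :
    p ∈ Set.range (Polynomial.map (algebraMap ℝ ℂ)) ↔ conjPoly p = p := by
  constructor
  · rintro ⟨q, rfl⟩
    ext n
    simp [coeff_conjPoly]
  · intro h
    have h' : p ∈ Polynomial.lifts (algebraMap ℝ ℂ) := by
      rw [lifts_iff_coeff_lifts]
      intro n
      obtain ⟨r, hr⟩ := Complex.conj_eq_iff_real.mp (by rw [← coeff_conjPoly, h] :
        conj (p.coeff n) = p.coeff n)
      exact ⟨r, hr.symm⟩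
    exact Polynomial.mem_lifts p |>.mp h'

theorem eval_shift (c : ℂ) (p : ℂ[X]) (z : ℂ) : (shift c p).eval z = p.eval (z + c) := by
  simp [shift]

theorem norm_eval_eq_prod_roots (f : ℂ[X]) (w : ℂ) :
    ‖f.eval w‖ = ‖f.leadingCoeff‖ * (f.roots.map fun ρ => ‖w - ρ‖).prod := by
  rw [(IsAlgClosed.splits f).eval_eq_prod_roots, norm_mul, ← normHom_apply (Multiset.prod _),
    map_multiset_prod, Multiset.map_map]
  rfl

/-! ### The logarithmic derivative above the zeros -/

theorem im_sum_one_div_sub_nonpos (s : Multiset ℂ) {z : ℂ} (hs : ∀ ρ ∈ s, ρ.im < z.im) :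
    (s.map fun ρ => 1 / (z - ρ)).sum.im ≤ 0 := by
  induction s using Multiset.induction_on with
  | empty => simp
  | cons ρ s ih =>
    have h1 := ih fun x hx => hs x (Multiset.mem_cons_of_mem hx)
    have h2 := hs ρ (Multiset.mem_cons_self _ _)
    have h3 : (1 / (z - ρ)).im ≤ 0 := by
      rw [one_div, Complex.inv_im]
      exact div_nonpos_of_nonpos_of_nonneg (by simp [h2.le]) (Complex.normSq_nonneg _)
    rw [Multiset.map_cons, Multiset.sum_cons, Complex.add_im]
    linarith

/-- Above all its zeros, a nonconstant polynomial has a logarithmic derivative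
`∑ 1 / (z - ρ)` of negative imaginary part. -/
theorem im_derivative_mul_conj_neg {f : ℂ[X]} {δ : ℝ} (hdeg : f.natDegree ≠ 0)
    (hf : ∀ z : ℂ, δ < z.im → f.eval z ≠ 0) {z : ℂ} (hz : δ < z.im) :
    ((derivative f).eval z * conj (f.eval z)).im < 0 := by
  have hz0 := hf z hz
  have hroots : ∀ ρ ∈ f.roots, ρ.im < z.im := fun ρ hρ => by
    by_contra! hlt
    exact hf ρ (hz.trans_le hlt) (isRoot_of_mem_roots hρ)
  have hne : f.roots ≠ 0 := (IsAlgClosed.splits f).roots_ne_zero hdeg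
  have hneg : ((derivative f).eval z / f.eval z).im < 0 := by
    rw [(IsAlgClosed.splits f).eval_derivative_div_eval_of_ne_zero hz0]
    obtain ⟨ρ, hρ⟩ := Multiset.exists_mem_of_ne_zero hne
    obtain ⟨s, hs⟩ := Multiset.exists_cons_of_mem hρ
    rw [hs] at hroots ⊢
    have h1 := im_sum_one_div_sub_nonpos s fun x hx => hroots x (Multiset.mem_cons_of_mem hx)
    have h2 := hroots ρ (Multiset.mem_cons_self _ _)
    have h3 : (1 / (z - ρ)).im < 0 := by
      rw [one_div, Complex.inv_im]
      refine div_neg_of_neg_of_pos (by simp [h2]) (Complex.normSq_pos.mpr ?_)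
      rintro h0
      rw [sub_eq_zero.mp h0] at h2
      exact lt_irrefl _ h2
    rw [Multiset.map_cons, Multiset.sum_cons, Complex.add_im]
    linarith
  have hfac : (derivative f).eval z * conj (f.eval z) =
      ((Complex.normSq (f.eval z) : ℝ) : ℂ) * ((derivative f).eval z / f.eval z) := by
    rw [← Complex.mul_conj]
    field_simp
  rw [hfac, Complex.im_ofReal_mul]
  exact mul_neg_of_pos_of_neg (Complex.normSq_pos.mpr hz0) hneg

theorem norm_le_of_forall_add_mul_ne_zero {u v : ℂ} (h : ∀ ω : ℂ, ‖ω‖ < 1 → u + ω * v ≠ 0) :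
    ‖v‖ ≤ ‖u‖ := by
  by_contra! hlt
  have hv : v ≠ 0 := by
    rintro rfl
    exact (norm_nonneg u).not_gt (by simpa using hlt)
  refine h (-u / v) ?_ (by field_simp; ring)
  rw [norm_div, norm_neg, div_lt_one (norm_pos_iff.mpr hv)]
  exact hlt

/-- The pointwise inequality behind the preservation step. With `a = Re α` and `b = Im α`, the
difference of squares `|u' - αu|² - |v' - conj α v|²` equals
`(|u' - au|² - |v' - av|²) + b² (|u|² - |v|²) - 2b (Im (u' conj u) + Im (v' conj v))`. -/
theorem norm_sub_conj_mul_le {u v u' v' α : ℂ} (huv : ‖v‖ ≤ ‖u‖)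
    (hre : ‖v' - (α.re : ℂ) * v‖ ≤ ‖u' - (α.re : ℂ) * u‖)
    (him : (u' * conj u).im + (v' * conj v).im ≤ 0) (hα : 0 ≤ α.im) :
    ‖v' - conj α * v‖ ≤ ‖u' - α * u‖ := by
  have key : ∀ {x y : ℂ}, ‖x‖ ≤ ‖y‖ ↔ x.re * x.re + x.im * x.im ≤ y.re * y.re + y.im * y.im := by
    intro x y
    rw [← Complex.normSq_apply, ← Complex.normSq_apply, Complex.normSq_eq_norm_sq,
      Complex.normSq_eq_norm_sq]
    exact (sq_le_sq₀ (norm_nonneg _) (norm_nonneg _)).symm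
  rw [key] at huv hre ⊢
  simp only [Complex.sub_re, Complex.sub_im, Complex.mul_re, Complex.mul_im, Complex.ofReal_re,
    Complex.ofReal_im, Complex.conj_re, Complex.conj_im] at *
  have h1 := mul_nonneg hα (neg_nonneg.mpr him)
  have h2 := mul_nonneg (mul_nonneg hα hα) (sub_nonneg.mpr huv)
  linarith

/-! ### The Hermite–Biehler property -/

/-- `F` has no zero above the line `Im z = δ` and dominates its conjugate `F*` there. -/
def HermiteBiehler (δ : ℝ) (F : ℂ[X]) : Prop :=
  ∀ z : ℂ, δ < z.im → F.eval z ≠ 0 ∧ ‖(conjPoly F).eval z‖ ≤ ‖F.eval z‖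

theorem HermiteBiehler.eval_add_mul_ne_zero {δ : ℝ} {F : ℂ[X]} (hF : HermiteBiehler δ F) {ω : ℂ}
    (hω : ‖ω‖ < 1) {z : ℂ} (hz : δ < z.im) : (F + C ω * conjPoly F).eval z ≠ 0 := by
  obtain ⟨h0, hle⟩ := hF z hz
  intro h
  rw [eval_add, eval_mul, eval_C] at h
  have h1 : ‖F.eval z‖ = ‖ω‖ * ‖(conjPoly F).eval z‖ := by
    rw [eq_neg_of_add_eq_zero_left h, norm_neg, norm_mul]
  have h2 := norm_pos_iff.mpr h0
  nlinarith [norm_nonneg ω]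

theorem natDegree_add_mul_conjPoly_ne_zero {F : ℂ[X]} (hF : F.natDegree ≠ 0) {ω : ℂ}
    (hω : ‖ω‖ < 1) : (F + C ω * conjPoly F).natDegree ≠ 0 := by
  intro h
  have hc : (F + C ω * conjPoly F).coeff F.natDegree = 0 :=
    coeff_eq_zero_of_natDegree_lt (by omega)
  rw [coeff_add, coeff_C_mul, coeff_conjPoly] at hc
  have h1 : ‖F.leadingCoeff‖ = ‖ω‖ * ‖F.leadingCoeff‖ := by
    conv_lhs => rw [leadingCoeff, eq_neg_of_add_eq_zero_left hc]
    rw [norm_neg, norm_mul, RCLike.norm_conj, leadingCoeff]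
  have h2 : 0 < ‖F.leadingCoeff‖ := norm_pos_iff.mpr (leadingCoeff_ne_zero.mpr (by
    rintro rfl
    simp at hF))
  nlinarith

theorem HermiteBiehler.smul {δ : ℝ} {F : ℂ[X]} (hF : HermiteBiehler δ F) {c : ℂ} (hc : c ≠ 0) :
    HermiteBiehler δ (c • F) := by
  intro z hz
  obtain ⟨h0, hle⟩ := hF z hz
  have e : conjPoly (c • F) = conj c • conjPoly F := Polynomial.map_smul _ _
  rw [e, eval_smul, eval_smul, smul_eq_mul, smul_eq_mul, norm_mul, norm_mul, RCLike.norm_conj]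
  exact ⟨mul_ne_zero hc h0, by gcongr⟩

/-- The basic preservation step: `D - α` with `Im α ≥ 0` preserves the Hermite–Biehler property,
unless it annihilates the polynomial. -/
theorem HermiteBiehler.derivative_sub {δ : ℝ} {F : ℂ[X]} (hF : HermiteBiehler δ F) {α : ℂ}
    (hα : 0 ≤ α.im) :
    derivative F - C α * F = 0 ∨ HermiteBiehler δ (derivative F - C α * F) := by
  by_cases hdeg : F.natDegree = 0
  · have hD : derivative F - C α * F = (-α) • F := by
      rw [derivative_of_natDegree_zero hdeg, smul_eq_C_mul, C_neg]
      ring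
    rw [hD]
    by_cases h0 : α = 0
    · left
      simp [h0]
    · exact Or.inr (hF.smul (neg_ne_zero.mpr h0))
  right
  intro z hz
  obtain ⟨-, hle⟩ := hF z hz
  have hpencil : ∀ ω : ℂ, ‖ω‖ < 1 →
      (((derivative F).eval z + ω * (derivative (conjPoly F)).eval z) *
        conj (F.eval z + ω * (conjPoly F).eval z)).im < 0 := by
    intro ω hω
    simpa using im_derivative_mul_conj_neg (natDegree_add_mul_conjPoly_ne_zero hdeg hω)
      (fun w hw => hF.eval_add_mul_ne_zero hω hw) hz
  have e : conjPoly (derivative F - C α * F) =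
      derivative (conjPoly F) - C (conj α) * conjPoly F := by
    rw [derivative_conjPoly]
    simp [conjPoly]
  rw [e]
  simp only [eval_sub, eval_mul, eval_C]
  generalize F.eval z = u at *
  generalize (conjPoly F).eval z = v at *
  generalize (derivative F).eval z = u' at *
  generalize (derivative (conjPoly F)).eval z = v' at *
  constructor
  · intro h
    have h1 := hpencil 0 (by simp)
    rw [zero_mul, zero_mul, add_zero, add_zero, sub_eq_zero.mp h, mul_assoc, Complex.mul_conj,
      Complex.im_mul_ofReal] at h1
    nlinarith [Complex.normSq_nonneg u]
  · refine norm_sub_conj_mul_le hle ?_ ?_ hα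
    · apply norm_le_of_forall_add_mul_ne_zero
      intro ω hω h
      have h1 := hpencil ω hω
      have h2 : u' + ω * v' = (α.re : ℂ) * (u + ω * v) := by linear_combination h
      rw [h2, mul_assoc, Complex.mul_conj, Complex.im_ofReal_mul, Complex.ofReal_im,
        mul_zero] at h1
      exact lt_irrefl _ h1
    · -- average the pencil inequality over `ω = ±t` and let `t → 1`
      have h1 : ∀ t : ℝ, |t| < 1 → (u' * conj u).im + t ^ 2 * (v' * conj v).im ≤ 0 := by
        intro t ht
        have hp := hpencil t (by simpa using ht)
        have hm := hpencil (-t) (by simpa using ht)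
        simp only [map_add, map_mul, map_neg, Complex.conj_ofReal, Complex.mul_im, Complex.add_re,
          Complex.add_im, Complex.mul_re, Complex.ofReal_re, Complex.ofReal_im, Complex.neg_re,
          Complex.neg_im] at hp hm ⊢
        linarith
      have h2 : Tendsto (fun t : ℝ => (u' * conj u).im + t ^ 2 * (v' * conj v).im) (𝓝[<] 1)
          (𝓝 ((u' * conj u).im + 1 ^ 2 * (v' * conj v).im)) :=
        tendsto_nhdsWithin_of_tendsto_nhds (Continuous.tendsto (by fun_prop) 1)
      have h3 := le_of_tendsto h2 (by
        filter_upwards [Ioo_mem_nhdsLT (show (-1 : ℝ) < 1 by norm_num)] with t ht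
        exact h1 t (abs_lt.mpr ht))
      simpa using h3

/-- `q(D)` preserves the Hermite–Biehler property, up to annihilation, when `q` has no zero in the
open lower half-plane. -/
theorem HermiteBiehler.aeval_derivative {δ : ℝ} {F : ℂ[X]} (hF : HermiteBiehler δ F) {q : ℂ[X]}
    (hq : ∀ z : ℂ, z.im < 0 → q.eval z ≠ 0) :
    aeval (derivative : Module.End ℂ ℂ[X]) q F = 0 ∨
      HermiteBiehler δ (aeval (derivative : Module.End ℂ ℂ[X]) q F) := by
  have hprod : ∀ s : Multiset ℂ, (∀ α ∈ s, 0 ≤ α.im) →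
      aeval (derivative : Module.End ℂ ℂ[X]) (s.map fun α => X - C α).prod F = 0 ∨
      HermiteBiehler δ
        (aeval (derivative : Module.End ℂ ℂ[X]) (s.map fun α => X - C α).prod F) := by
    intro s
    induction s using Multiset.induction_on with
    | empty => exact fun _ => Or.inr (by simpa using hF)
    | cons α s ih =>
      intro hs
      have hfac : ∀ G : ℂ[X], aeval (derivative : Module.End ℂ ℂ[X]) (X - C α) G =
          derivative G - C α * G := by
        intro G
        rw [map_sub, aeval_X, aeval_C, LinearMap.sub_apply, Module.algebraMap_end_apply,
          smul_eq_C_mul]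
      rw [Multiset.map_cons, Multiset.prod_cons, map_mul, Module.End.mul_apply, hfac]
      rcases ih fun x hx => hs x (Multiset.mem_cons_of_mem hx) with h | h
      · left
        rw [h]
        simp
      · exact h.derivative_sub (hs α (Multiset.mem_cons_self _ _))
  have hq0 : q ≠ 0 := by
    rintro rfl
    exact hq (-Complex.I) (by simp) eval_zero
  rw [(IsAlgClosed.splits q).eq_prod_roots, map_mul, aeval_C, Module.End.mul_apply,
    Module.algebraMap_end_apply]
  rcases hprod q.roots fun α hα => by
      by_contra! hlt
      exact hq α hlt (isRoot_of_mem_roots hα) with h | h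
  · left
    rw [h, smul_zero]
  · exact Or.inr (h.smul (leadingCoeff_ne_zero.mpr hq0))

/-! ### Shifts of real polynomials -/

/-- The distances from `z + i lam` to a conjugate pair `ρ`, `conj ρ` have at least as large a product
as those from `z - i lam`. The difference of the squared products is
`8 Im z · lam · (Re (z - ρ) ^ 2 + Im z ^ 2 + lam ^ 2 - Im ρ ^ 2)`. -/
theorem norm_sub_mul_norm_sub_le {lam : ℝ} (hlam : 0 ≤ lam) {z ρ : ℂ} (hz : 0 ≤ z.im)
    (h : ρ.im ^ 2 - lam ^ 2 ≤ z.im ^ 2) :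
    ‖z - Complex.I * lam - ρ‖ * ‖z - Complex.I * lam - conj ρ‖ ≤
      ‖z + Complex.I * lam - ρ‖ * ‖z + Complex.I * lam - conj ρ‖ := by
  rw [← sq_le_sq₀ (by positivity) (by positivity), mul_pow, mul_pow]
  simp only [← Complex.normSq_eq_norm_sq, Complex.normSq_apply]
  simp only [Complex.sub_re, Complex.sub_im, Complex.add_re, Complex.add_im, Complex.mul_re,
    Complex.mul_im, Complex.I_re, Complex.I_im, Complex.ofReal_re, Complex.ofReal_im,
    Complex.conj_re, Complex.conj_im]
  have h1 := mul_nonneg (mul_nonneg hz hlam) (sub_nonneg.mpr h)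
  have h2 := mul_nonneg (mul_nonneg hz hlam) (sq_nonneg (z.re - ρ.re))
  nlinarith

theorem hermiteBiehler_shift {μ lam : ℝ} (hlam : 0 ≤ lam) {p : ℂ[X]}
    (hp : p ∈ realStripPolys μ) :
    HermiteBiehler (Real.sqrt (max (μ ^ 2 - lam ^ 2) 0)) (shift (Complex.I * lam) p) := by
  obtain ⟨hstrip, hreal⟩ := hp
  rw [mem_range_map_real_iff] at hreal
  intro z hz
  have hδ := Real.sqrt_nonneg (max (μ ^ 2 - lam ^ 2) 0)
  have hδsq := Real.sq_sqrt (le_max_right (μ ^ 2 - lam ^ 2) 0)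
  have hmax := le_max_left (μ ^ 2 - lam ^ 2) 0
  have hz0 : 0 < z.im := hδ.trans_lt hz
  have hzsq : μ ^ 2 - lam ^ 2 ≤ z.im ^ 2 := by nlinarith
  rw [conjPoly_shift, hreal, eval_shift, eval_shift]
  have hc : conj (Complex.I * (lam : ℂ)) = -(Complex.I * lam) := by simp
  rw [hc, ← sub_eq_add_neg]
  constructor
  · apply hstrip
    have him : (z + Complex.I * lam).im = z.im + lam := by simp
    rw [Set.mem_ofPred_eq, him, abs_of_pos (by linarith)]
    have : μ ^ 2 < (z.im + lam) ^ 2 := by nlinarith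
    exact lt_of_pow_lt_pow_left₀ 2 (by linarith) this
  · have hroot : ∀ ρ ∈ p.roots, ρ.im ^ 2 - lam ^ 2 ≤ z.im ^ 2 := by
      intro ρ hρ
      have h1 : |ρ.im| ≤ μ := by
        by_contra! hlt
        exact hstrip ρ hlt (isRoot_of_mem_roots hρ)
      have h2 := sq_le_sq' (by linarith [abs_nonneg ρ.im, neg_abs_le ρ.im])
          ((le_abs_self _).trans h1)
      linarith
    -- since `p* = p`, the square of `|p(w)|` is `|p(w)| |p(conj w)|`
    have hsq : ∀ w : ℂ, ‖p.eval w‖ ^ 2 = ‖p.leadingCoeff‖ ^ 2 *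
        (p.roots.map fun ρ => ‖w - ρ‖ * ‖w - conj ρ‖).prod := by
      intro w
      have hconj : ‖p.eval w‖ = ‖p.eval (conj w)‖ := by
        conv_lhs => rw [← hreal, eval_conjPoly, RCLike.norm_conj]
      have hdist : ∀ ρ : ℂ, ‖conj w - ρ‖ = ‖w - conj ρ‖ := by
        intro ρ
        rw [← RCLike.norm_conj (conj w - ρ)]
        simp
      rw [sq]
      nth_rewrite 2 [hconj]
      rw [norm_eval_eq_prod_roots, norm_eval_eq_prod_roots, Multiset.prod_map_mul]
      simp only [hdist]
      ring
    rw [← sq_le_sq₀ (norm_nonneg _) (norm_nonneg _), hsq, hsq]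
    refine mul_le_mul_of_nonneg_left ?_ (by positivity)
    exact Multiset.prod_map_le_prod_map₀ _ _ (fun ρ _ => by positivity)
      fun ρ hρ => norm_sub_mul_norm_sub_le hlam hz0.le (hroot ρ hρ)

/-! ### Differential operators and Taylor coefficients -/

theorem diffOp_eq_sum (a : ℕ → ℂ) (p : ℂ[X]) {n : ℕ} (hn : p.natDegree < n) :
    diffOp a p = ∑ k ∈ Finset.range n, a k • derivative^[k] p :=
  sum_derivative_eq a p hn

theorem diffOp_coeff (q p : ℂ[X]) :
    diffOp q.coeff p = aeval (derivative : Module.End ℂ ℂ[X]) q p := by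
  rw [diffOp_eq_sum _ _ (n := max p.natDegree q.natDegree + 1) (by omega),
    aeval_eq_sum_range' (n := max p.natDegree q.natDegree + 1) (by omega),
    LinearMap.sum_apply]
  exact Finset.sum_congr rfl fun k _ => by rw [LinearMap.smul_apply, Module.End.pow_apply]

theorem conjPoly_diffOp (a : ℕ → ℂ) (p : ℂ[X]) :
    conjPoly (diffOp a p) = diffOp (fun k => conj (a k)) (conjPoly p) := by
  rw [diffOp_eq_sum a p (Nat.lt_succ_self _),
    diffOp_eq_sum _ (conjPoly p) (by rw [natDegree_conjPoly]; exact Nat.lt_succ_self _)]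
  simp [conjPoly, Polynomial.map_sum, Polynomial.map_smul, iterate_derivative_map]

theorem taylorCoeffs_conjFun (f : ℂ → ℂ) (k : ℕ) :
    taylorCoeffs (conjFun f) k = conj (taylorCoeffs f k) := by
  have h : iteratedDeriv k (conjFun f) = conj ∘ iteratedDeriv k f ∘ conj := by
    induction k with
    | zero =>
      rw [iteratedDeriv_zero, iteratedDeriv_zero]
      rfl
    | succ k ih => rw [iteratedDeriv_succ, iteratedDeriv_succ, ih, deriv_conj_conj]
  simp [taylorCoeffs, h]

theorem taylorCoeffs_exp (c : ℂ) (k : ℕ) :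
    taylorCoeffs (fun w => Complex.exp (c * w)) k = c ^ k / (k.factorial : ℂ) := by
  simp [taylorCoeffs, iteratedDeriv_cexp_const_mul]

theorem taylorCoeffs_eval (q : ℂ[X]) (k : ℕ) : taylorCoeffs (fun z => q.eval z) k = q.coeff k := by
  have h : iteratedDeriv k (fun z => q.eval z) = fun z => (derivative^[k] q).eval z := by
    induction k with
    | zero => simp
    | succ k ih =>
      rw [iteratedDeriv_succ, ih, Function.iterate_succ_apply']
      ext z
      exact Polynomial.deriv _
  rw [taylorCoeffs, h]
  beta_reduce
  rw [← coeff_zero_eq_eval_zero, coeff_iterate_derivative]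
  simp [Nat.descFactorial_self, Nat.factorial_ne_zero]

/-- Taylor's formula: `e^{cD}` is the shift by `c`. -/
theorem entireOp_exp (c : ℂ) (p : ℂ[X]) :
    entireOp (fun w => Complex.exp (c * w)) p = shift c p := by
  refine Polynomial.funext fun z => ?_
  rw [entireOp, diffOp_eq_sum _ _ (Nat.lt_succ_self _), eval_shift, add_comm, ← taylor_eval,
    eval_eq_sum_range (p := taylor z p), natDegree_taylor, eval_finsetSum]
  refine Finset.sum_congr rfl fun k _ => ?_
  rw [taylor_coeff, taylorCoeffs_exp, ← factorial_smul_hasseDeriv, LinearMap.smul_apply, eval_smul,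
    eval_smul, nsmul_eq_mul, smul_eq_mul]
  have : (k.factorial : ℂ) ≠ 0 := Nat.cast_ne_zero.mpr k.factorial_ne_zero
  field_simp

/-- Taylor coefficients are continuous under uniform convergence on compact sets, by Cauchy's
estimates. -/
theorem tendsto_coeff_taylorCoeffs {q : ℕ → ℂ[X]} {h : ℂ → ℂ}
    (hq : ∀ K : Set ℂ, IsCompact K → TendstoUniformlyOn (fun n z => (q n).eval z) h atTop K)
    (k : ℕ) : Tendsto (fun n => (q n).coeff k) atTop (𝓝 (taylorCoeffs h k)) := by
  have hloc : TendstoLocallyUniformlyOn (fun n => iteratedDeriv k fun z => (q n).eval z)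
      (iteratedDeriv k h) atTop Set.univ := by
    induction k with
    | zero =>
      simp only [iteratedDeriv_zero]
      exact (tendstoLocallyUniformlyOn_iff_forall_isCompact isOpen_univ).mpr
        fun K _ hK => hq K hK
    | succ k ih =>
      simp only [iteratedDeriv_succ]
      refine ih.deriv (Eventually.of_forall fun n => ?_) isOpen_univ
      have hd : ContDiff ℂ (k + 1 : ℕ) fun z => (q n).eval z := by
        simpa using (q n).contDiff_aeval (𝕜 := ℂ) (k + 1 : ℕ)
      exact (hd.differentiable_iteratedDeriv k (by exact_mod_cast k.lt_succ_self)).differentiableOn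
  simp only [← taylorCoeffs_eval]
  exact (hloc.tendsto_at (Set.mem_univ 0)).div_const _

theorem tendsto_eval_diffOp {b : ℕ → ℕ → ℂ} {a : ℕ → ℂ}
    (hb : ∀ k, Tendsto (fun n => b n k) atTop (𝓝 (a k))) (p : ℂ[X]) (z : ℂ) :
    Tendsto (fun n => (diffOp (b n) p).eval z) atTop (𝓝 ((diffOp a p).eval z)) := by
  simp only [diffOp_eq_sum _ p (Nat.lt_succ_self _), eval_finsetSum, eval_smul]
  exact tendsto_finsetSum _ fun k _ => (hb k).smul_const _

theorem natDegree_diffOp_le (a : ℕ → ℂ) (p : ℂ[X]) : (diffOp a p).natDegree ≤ p.natDegree := by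
  rw [diffOp_eq_sum _ p (Nat.lt_succ_self _)]
  refine natDegree_sum_le_of_forall_le _ _ fun k _ => ?_
  exact (natDegree_smul_le _ _).trans ((natDegree_iterate_derivative _ _).trans (Nat.sub_le _ _))

/-! ### Limits of zero-free polynomials of bounded degree -/

/-- A Harnack-type inequality: every zero `ρ` has distance at least `r` from the centre, so that
`|z - ρ| ≤ 2 |z₀ - ρ|` throughout the ball. -/
theorem norm_eval_le_of_forall_ne_zero {f : ℂ[X]} {z₀ z : ℂ} {r : ℝ} {N : ℕ}
    (hN : f.natDegree ≤ N) (hf : ∀ w ∈ Metric.ball z₀ r, f.eval w ≠ 0)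
    (hz : z ∈ Metric.ball z₀ r) : ‖f.eval z‖ ≤ 2 ^ N * ‖f.eval z₀‖ := by
  have hprod : (f.roots.map fun ρ => ‖z - ρ‖).prod ≤
      (f.roots.map fun ρ => 2 * ‖z₀ - ρ‖).prod := by
    refine Multiset.prod_map_le_prod_map₀ _ _ (fun ρ _ => norm_nonneg _) fun ρ hρ => ?_
    have h1 : r ≤ ‖z₀ - ρ‖ := by
      by_contra! hlt
      refine hf ρ ?_ (isRoot_of_mem_roots hρ)
      rwa [Metric.mem_ball, dist_comm, dist_eq_norm]
    have h2 : ‖z - z₀‖ < r := by rwa [← dist_eq_norm]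
    have h3 := norm_sub_le_norm_sub_add_norm_sub z z₀ ρ
    linarith
  rw [Multiset.prod_map_mul, Multiset.map_const', Multiset.prod_replicate] at hprod
  have hpow : (2 : ℝ) ^ f.roots.card ≤ 2 ^ N :=
    pow_le_pow_right₀ one_le_two ((card_roots' f).trans hN)
  have hnonneg : 0 ≤ (f.roots.map fun ρ => ‖z₀ - ρ‖).prod :=
    Multiset.prod_map_nonneg fun ρ _ => norm_nonneg _
  rw [norm_eval_eq_prod_roots, norm_eval_eq_prod_roots]
  calc ‖f.leadingCoeff‖ * (f.roots.map fun ρ => ‖z - ρ‖).prod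
      ≤ ‖f.leadingCoeff‖ * (2 ^ N * (f.roots.map fun ρ => ‖z₀ - ρ‖).prod) := by
        gcongr
        exact hprod.trans (by gcongr)
    _ = 2 ^ N * (‖f.leadingCoeff‖ * (f.roots.map fun ρ => ‖z₀ - ρ‖).prod) := by ring

/-- Hurwitz's theorem for polynomials of bounded degree, under pointwise convergence. -/
theorem eq_zero_or_forall_ne_zero_of_tendsto {f : ℕ → ℂ[X]} {g : ℂ[X]} {N : ℕ} {U : Set ℂ}
    (hU : IsOpen U) (hN : ∀ n, (f n).natDegree ≤ N)
    (hf : ∀ n, f n = 0 ∨ ∀ z ∈ U, (f n).eval z ≠ 0)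
    (hlim : ∀ z, Tendsto (fun n => (f n).eval z) atTop (𝓝 (g.eval z))) :
    g = 0 ∨ ∀ z ∈ U, g.eval z ≠ 0 := by
  rw [or_iff_not_imp_right]
  intro hne
  push Not at hne
  obtain ⟨z₀, hz₀, hg⟩ := hne
  obtain ⟨r, hr, hball⟩ := Metric.isOpen_iff.mp hU z₀ hz₀
  have hzero : ∀ z ∈ Metric.ball z₀ r, g.eval z = 0 := by
    intro z hz
    have hle : ∀ n, ‖(f n).eval z‖ ≤ 2 ^ N * ‖(f n).eval z₀‖ := by
      intro n
      rcases hf n with h | h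
      · simp [h]
      · exact norm_eval_le_of_forall_ne_zero (hN n) (fun w hw => h w (hball hw)) hz
    have h := le_of_tendsto_of_tendsto' (hlim z).norm ((hlim z₀).norm.const_mul (2 ^ N)) hle
    rw [hg, norm_zero, mul_zero] at h
    exact norm_le_zero_iff.mp h
  refine Polynomial.eq_of_infinite_eval_eq g 0 ((infinite_of_mem_nhds z₀
    (Metric.ball_mem_nhds z₀ hr)).mono fun z hz => ?_)
  simpa using hzero z hz

/-- For a limit `h` of polynomials without zeros in the lower half-plane and `F` with the
Hermite–Biehler property, the real polynomial `h(D) F + (h(D) F)*` vanishes identically or has no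
zero above the line. -/
theorem HermiteBiehler.entireOp_add_conjPoly {δ : ℝ} {F : ℂ[X]} (hF : HermiteBiehler δ F)
    {h : ℂ → ℂ} (hh : h ∈ stableClosure (conjSet upperHalf)) :
    entireOp h F + conjPoly (entireOp h F) = 0 ∨
      ∀ z : ℂ, δ < z.im → (entireOp h F + conjPoly (entireOp h F)).eval z ≠ 0 := by
  obtain ⟨q, hq, hlim⟩ := hh
  have hq' : ∀ n, ∀ z : ℂ, z.im < 0 → (q n).eval z ≠ 0 := fun n z hz =>
    hq n z ⟨conj z, by simpa [upperHalf] using hz, Complex.conj_conj z⟩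
  have hcoeff := tendsto_coeff_taylorCoeffs hlim
  have hpt : ∀ z, Tendsto (fun n => (diffOp (q n).coeff F).eval z) atTop
      (𝓝 ((entireOp h F).eval z)) := tendsto_eval_diffOp hcoeff F
  -- the Hermite–Biehler property excludes zeros of `G + ω G*` for `|ω| < 1` only, so that `ω` has
  -- to tend to `1` along with the approximation of `h`
  let ω : ℕ → ℝ := fun n => 1 - 1 / ((n : ℝ) + 1)
  have hω1 : ∀ n, ‖(ω n : ℂ)‖ < 1 := by
    intro n
    have hpos : (0 : ℝ) < (n : ℝ) + 1 := by positivity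
    have h1 : 0 < 1 / ((n : ℝ) + 1) := by positivity
    have h2 : 1 / ((n : ℝ) + 1) ≤ 1 := by
      rw [div_le_one hpos]
      linarith [Nat.cast_nonneg (α := ℝ) n]
    rw [Complex.norm_real, Real.norm_eq_abs, abs_lt]
    constructor <;> simp only [ω] <;> linarith
  have hωlim : Tendsto (fun n => (ω n : ℂ)) atTop (𝓝 1) := by
    have h1 : Tendsto ω atTop (𝓝 (1 - 0)) :=
      tendsto_const_nhds.sub tendsto_one_div_add_atTop_nhds_zero_nat
    rw [sub_zero] at h1
    exact_mod_cast (Complex.continuous_ofReal.tendsto 1).comp h1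
  refine eq_zero_or_forall_ne_zero_of_tendsto (N := F.natDegree) (U := {z : ℂ | δ < z.im})
    (f := fun n => diffOp (q n).coeff F + C (ω n : ℂ) * conjPoly (diffOp (q n).coeff F))
    (isOpen_lt continuous_const Complex.continuous_im) (fun n => ?_) (fun n => ?_) (fun z => ?_)
  · refine natDegree_add_le_of_degree_le (natDegree_diffOp_le _ _)
      ((natDegree_C_mul_le _ _).trans ?_)
    rw [natDegree_conjPoly]
    exact natDegree_diffOp_le _ _
  · simp only [diffOp_coeff]
    rcases hF.aeval_derivative (hq' n) with h0 | h0
    · left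
      rw [h0, conjPoly_zero, mul_zero, add_zero]
    · exact Or.inr fun z hz => h0.eval_add_mul_ne_zero (hω1 n) hz
  · simp only [eval_add, eval_mul, eval_C, eval_conjPoly]
    have h1 := (hpt z).add (hωlim.mul ((Complex.continuous_conj.tendsto _).comp (hpt (conj z))))
    rwa [one_mul] at h1

end StripPreserver

theorem theorem1p6 (μ lam : ℝ) (hlam : 0 ≤ lam) (h : ℂ → ℂ)
    (hh : h ∈ StripPreserver.stableClosure (StripPreserver.conjSet StripPreserver.upperHalf))
    (a : ℕ → ℂ) (T Tstar : Polynomial ℂ →ₗ[ℂ] Polynomial ℂ)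
    (hTa : T = StripPreserver.diffOp a)
    (hT : T = StripPreserver.entireOp h ∘ₗ
      StripPreserver.entireOp (fun w => Complex.exp (Complex.I * (lam : ℂ) * w)))
    (hTstar : Tstar = StripPreserver.diffOp (fun k => (starRingEnd ℂ) (a k)))
    (p : Polynomial ℂ) (hp : p ∈ StripPreserver.realStripPolys μ) :
    (T + Tstar) p =
        StripPreserver.entireOp h (StripPreserver.shift (Complex.I * (lam : ℂ)) p) +
          StripPreserver.entireOp (StripPreserver.conjFun h)
            (StripPreserver.shift (-(Complex.I * (lam : ℂ))) p) ∧
      ((T + Tstar) p = 0 ∨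
        (T + Tstar) p ∈
          StripPreserver.realStripPolys (Real.sqrt (max (μ ^ 2 - lam ^ 2) 0))) := by
  open StripPreserver ComplexConjugate in
  have hreal : conjPoly p = p := (mem_range_map_real_iff p).mp hp.2
  have hTp : T p = entireOp h (shift (Complex.I * lam) p) := by
    rw [hT, LinearMap.comp_apply, entireOp_exp]
  have hTstarp : Tstar p = conjPoly (T p) := by
    rw [hTstar, hTa, conjPoly_diffOp, hreal]
  have hconj : conjPoly (entireOp h (shift (Complex.I * lam) p)) =
      entireOp (conjFun h) (shift (-(Complex.I * lam)) p) := by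
    rw [entireOp, conjPoly_diffOp, conjPoly_shift, hreal, entireOp]
    simp only [funext (taylorCoeffs_conjFun h), map_mul, Complex.conj_I, Complex.conj_ofReal,
      neg_mul]
  have hsum : (T + Tstar) p = entireOp h (shift (Complex.I * lam) p) +
      conjPoly (entireOp h (shift (Complex.I * lam) p)) := by
    rw [LinearMap.add_apply, hTstarp, hTp]
  refine ⟨by rw [hsum, hconj], ?_⟩
  rw [hsum]
  refine ((hermiteBiehler_shift hlam hp).entireOp_add_conjPoly hh).imp_right fun hne => ?_
  set G := entireOp h (shift (Complex.I * lam) p)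
  have hG : conjPoly (G + conjPoly G) = G + conjPoly G := by
    rw [conjPoly_add, conjPoly_conjPoly, add_comm]
  refine ⟨fun z hz => ?_, (mem_range_map_real_iff _).mpr hG⟩
  rcases lt_abs.mp (show _ < |z.im| from hz) with hz | hz
  · exact hne z hz
  · -- a zero below the strip reflects to one above it
    intro h0
    refine hne (conj z) (by simpa using hz) ?_
    rw [← hG, eval_conjPoly, Complex.conj_conj, h0, map_zero]
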